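/- Theorem. Let $d = 2^l$ with $l \in \mathbb{N}$, and let $\sigma > 0$. Let $H = H_d \in \{-1,1\}^{d\times d}$ be the (unnormalised) Walsh–Hadamard matrix, defined by $H_1 = (1)$ and $H_{2m} = \begin{pmatrix} H_m & H_m \\ H_m & -H_m \end{pmatrix}$. Let $G$ be a random $d \times d$ diagonal matrix with i.i.d. standard normal diagonal entries, $B$ a random $d \times d$ diagonal matrix with i.i.d. diagonal entries uniform on $\{-1,1\}$, and $\Pi$ a uniformly random $d\times d$ permutation matrix, with $G, \Pi, B$ independent. For $x, x' \in \mathbb{R}^d$ let $$k(x,x') = e^{-\|x-x'\|^2/(2\sigma^2)}, \qquad \hat k(x,x') = \frac1d \sum_{j=1}^d \cos\left(d^{-1/2}\,[HG\Pi HB(x-x')/\sigma]_j\right)$$ be the Gaussian RBF kernel and its Fastfood estimate from a single $d \times d$ block, where $\|\cdot\|$ is the Euclidean norm. For $\delta > 0$ put $$\varepsilon_\delta(x,x') = 2\sigma^{-1} d^{-1/2}\,\|x-x'\|\,\sqrt{\log(2/\delta)\,\log(2d/\delta)},$$ where the square root of a negative number is read as $0$ (this can only happen for $\delta > 2$, when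 the claims are trivial). Then for all $x, x' \in \mathbb{R}^d$ with $x \neq x'$ and all $\delta > 0$, $$\mathbf{P}\left[\,|\hat k(x,x') - k(x,x')| \ge \varepsilon_\delta(x,x')\right] \le 2\delta,$$ and for all $x, x' \in \mathbb{R}^d$ (including $x = x'$) and all $\delta > 0$, $$\mathbf{P}\left[\,|\hat k(x,x') - k(x,x')| \le \varepsilon_\delta(x,x')\right] \ge 1 - 2\delta.$$ -/

import Mathlib

open MeasureTheory ProbabilityTheory
open scoped ENNReal

noncomputable section

namespace Fastfood

/-- The unnormalised Walsh-Hadamard matrix `H_d` with `d = 2 ^ l`, by the block recursion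
`H_1 = (1)`, `H_{2d} = ((H_d, H_d), (H_d, -H_d))`. -/
def hadamardMatrix : (l : ℕ) → Matrix (Fin (2 ^ l)) (Fin (2 ^ l)) ℝ
  | 0 => Matrix.of fun _ _ => 1
  | l + 1 =>
    let e : Fin (2 ^ l) ⊕ Fin (2 ^ l) ≃ Fin (2 ^ (l + 1)) :=
      finSumFinEquiv.trans (finCongr (by rw [pow_succ, mul_two]))
    Matrix.reindex e e
      (Matrix.fromBlocks (hadamardMatrix l) (hadamardMatrix l)
        (hadamardMatrix l) (-hadamardMatrix l))

/-- The uniform distribution on `{-1, 1}`, as a measure on `ℝ`. -/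
def signLaw : Measure ℝ :=
  (2⁻¹ : ℝ≥0∞) • Measure.dirac (1 : ℝ) + (2⁻¹ : ℝ≥0∞) • Measure.dirac (-1 : ℝ)

instance : IsProbabilityMeasure signLaw :=
  ⟨by simp [signLaw, ENNReal.inv_two_add_inv_two]⟩

instance permMeasurableSpace (n : ℕ) : MeasurableSpace (Equiv.Perm (Fin n)) := ⊤

/-- The uniform distribution on the permutations of `{0, …, n - 1}`. -/
def permLaw (n : ℕ) : Measure (Equiv.Perm (Fin n)) :=
  (PMF.uniformOfFintype (Equiv.Perm (Fin n))).toMeasure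

instance (n : ℕ) : IsProbabilityMeasure (permLaw n) := by
  unfold permLaw; infer_instance

/-- The randomness of one block: the diagonal `g` of `G`, the permutation `π` behind `Π`,
and the diagonal `b` of `B`. -/
abbrev Params (n : ℕ) : Type := (Fin n → ℝ) × Equiv.Perm (Fin n) × (Fin n → ℝ)

/-- The law of `(g, π, b)`: `g` has i.i.d. standard normal entries, `π` is a uniform permutation,
`b` has i.i.d. uniform signs as entries, and `g`, `π`, `b` are independent. -/
def law (n : ℕ) : Measure (Params n) :=
  (Measure.pi fun _ => gaussianReal 0 1).prod
    ((permLaw n).prod (Measure.pi fun _ => signLaw))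

instance (n : ℕ) : IsProbabilityMeasure (law n) := by
  unfold law; infer_instance

/-- The random matrix `H G Π H B`. -/
def block (l : ℕ) (p : Params (2 ^ l)) : Matrix (Fin (2 ^ l)) (Fin (2 ^ l)) ℝ :=
  hadamardMatrix l * Matrix.diagonal p.1 * Equiv.Perm.permMatrix ℝ p.2.1 * hadamardMatrix l *
    Matrix.diagonal p.2.2

/-- The Gaussian RBF kernel `k(x, x') = exp(-‖x - x'‖² / (2σ²))`. -/
def rbfKernel {n : ℕ} (σ : ℝ) (x x' : EuclideanSpace ℝ (Fin n)) : ℝ :=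
  Real.exp (-‖x - x'‖ ^ 2 / (2 * σ ^ 2))

/-- The estimate `d⁻¹ ∑ⱼ cos(d^{-1/2} [H G Π H B (x - x') / σ]ⱼ)` of the RBF kernel from one
`d × d` block, `d = 2 ^ l`. -/
def kernelEstimate (l : ℕ) (σ : ℝ) (x x' : EuclideanSpace ℝ (Fin (2 ^ l)))
    (p : Params (2 ^ l)) : ℝ :=
  (∑ j, Real.cos
    ((√((2 : ℝ) ^ l))⁻¹ * ((block l p).mulVec (fun i => (x i - x' i) / σ)) j)) / (2 : ℝ) ^ l

/-- The deviation `2 σ⁻¹ d^{-1/2} ‖x - x'‖ √(log(2/δ) log(2d/δ))`, `d = 2 ^ l`. -/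
def deviation (l : ℕ) (σ δ : ℝ) (x x' : EuclideanSpace ℝ (Fin (2 ^ l))) : ℝ :=
  2 * σ⁻¹ * (√((2 : ℝ) ^ l))⁻¹ * ‖x - x'‖ *
    √(Real.log (2 / δ) * Real.log (2 * (2 : ℝ) ^ l / δ))

end Fastfood

end

/-! Put `v = (x - x') / σ`, `R = ‖v‖²` and `a = H B v`, and fix the permutation and the signs. The
estimate is then `F(g) / d` with `F(g) = ∑ⱼ cos ⟨uⱼ, g⟩` and `uⱼᵢ = d^{-1/2} Hⱼᵢ a_{π i}`. Since `H²
= d` and `H` has entries `±1`, every `‖uⱼ‖²` equals `R`, so `F / d` has Gaussian mean `exp(-R/2)`,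
the kernel itself. The permutation only reindexes sums, and all bounds hold for each `π`.

If `|aᵢ| ≤ M` for all `i`, then `|∇F|² ≤ M² d`: up to sign, the gradient is `d^{-1/2} a_{π i} (H
s)ᵢ` with `s` a vector of sines, and `‖H s‖² = d ‖s‖² ≤ d²`. Gaussian concentration with variance
proxy `M² d` follows (`integral_exp_mul_cosSum_le`). Hoeffding's inequality and a union bound over
the `d` entries of `a` allow `M² = 2 R log(2d/δ)` outside an event of probability `δ`; the Gaussian
tail costs another `δ`.

The sharp concentration constant comes from interpolation. With `g'` an independent copy of `g`,
averaging `F(t g + √(1-t²) g')` over `g'` gives `e^{-(1-t²)R/2} F(t g)`, because each cosine is an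
eigenfunction of the Laplacian. This runs from the mean at `t = 0` to `F(g)` at `t = 1`. In the
derivative of its moment generating function, Gaussian integration by parts cancels the eigenvalue
term and leaves a multiple of `|∇F|²`; Grönwall's argument concludes. -/

/-! ### Gaussian integration by parts -/

/-- Stein's identity: the density `p` satisfies `p' = -x p`, so `p f' - x p f` is the derivative of
the integrable function `p f` and integrates to zero. -/
theorem ProbabilityTheory.integral_id_mul_gaussianReal {f f' : ℝ → ℝ} {C C' : ℝ}
    (hf : ∀ x, HasDerivAt f (f' x) x) (hf' : Continuous f') (hC : ∀ x, |f x| ≤ C)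
    (hC' : ∀ x, |f' x| ≤ C') :
    ∫ x, x * f x ∂(gaussianReal 0 1) = ∫ x, f' x ∂(gaussianReal 0 1) := by
  have hcont : Continuous f := continuous_iff_continuousAt.2 fun x => (hf x).continuousAt
  rw [integral_gaussianReal_eq_integral_smul one_ne_zero,
    integral_gaussianReal_eq_integral_smul one_ne_zero, ← sub_eq_zero, ← neg_eq_zero, neg_sub]
  have hi0 : Integrable (gaussianPDFReal 0 1) := integrable_gaussianPDFReal 0 1
  have hi1 : Integrable (fun x => gaussianPDFReal 0 1 x * x) := by
    have := (integrable_mul_exp_neg_mul_sq (b := 1 / 2) (by norm_num)).const_mul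
      (√(2 * Real.pi * 1))⁻¹
    refine this.congr (ae_of_all _ fun x => ?_)
    simp only [gaussianPDFReal, NNReal.coe_one, sub_zero]
    ring_nf
  have hA : Integrable (fun x => gaussianPDFReal 0 1 x • f' x) :=
    hi0.mul_bdd hf'.aestronglyMeasurable (ae_of_all _ hC')
  have hB : Integrable (fun x => gaussianPDFReal 0 1 x • (x * f x)) := by
    refine (hi1.mul_bdd hcont.aestronglyMeasurable (ae_of_all _ hC)).congr
      (ae_of_all _ fun x => ?_)
    simp [mul_assoc]
  rw [← integral_sub hA hB]
  refine integral_eq_zero_of_hasDerivAt_of_integrable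
    (f := fun x => gaussianPDFReal 0 1 x * f x) (fun x => ?_) (hA.sub hB)
    (hi0.mul_bdd hcont.aestronglyMeasurable (ae_of_all _ hC))
  have hpdf : HasDerivAt (gaussianPDFReal 0 1) (-(x * gaussianPDFReal 0 1 x)) x := by
    have h : HasDerivAt (fun y : ℝ => -(y - 0) ^ 2 / (2 * ((1 : NNReal) : ℝ))) (-x) x := by
      have := (((hasDerivAt_id x).sub_const 0).pow 2).neg.div_const (2 * ((1 : NNReal) : ℝ))
      refine this.congr_deriv ?_
      simp
      ring
    refine (h.exp.const_mul (√(2 * Real.pi * ((1 : NNReal) : ℝ)))⁻¹).congr_deriv ?_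
    rw [gaussianPDFReal]
    ring
  refine (hpdf.mul (hf x)).congr_deriv ?_
  simp only [smul_eq_mul]
  ring

/-- The standard Gaussian measure on `Fin n → ℝ`. -/
noncomputable abbrev stdGaussianPi (n : ℕ) : Measure (Fin n → ℝ) :=
  Measure.pi fun _ => gaussianReal 0 1

theorem integrable_of_continuous_of_bounded {X : Type*} [TopologicalSpace X] [MeasurableSpace X]
    [OpensMeasurableSpace X] [SecondCountableTopology X] {μ : Measure X} [IsFiniteMeasure μ]
    {f : X → ℝ} (hf : Continuous f) {C : ℝ} (hC : ∀ x, |f x| ≤ C) : Integrable f μ :=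
  Integrable.of_bound hf.aestronglyMeasurable C (ae_of_all _ hC)

theorem integrable_eval_stdGaussianPi {n : ℕ} (i : Fin n) :
    Integrable (fun g => g i) (stdGaussianPi n) := by
  have h : Integrable (id : ℝ → ℝ) (gaussianReal 0 1) :=
    (memLp_id_gaussianReal 1).integrable le_rfl
  exact (measurePreserving_eval (fun _ : Fin n => gaussianReal 0 1) i).integrable_comp_of_integrable
    h

theorem integrable_eval_mul_stdGaussianPi {n : ℕ} (i : Fin n) {F : (Fin n → ℝ) → ℝ} {C : ℝ}
    (hF : Continuous F) (hC : ∀ g, |F g| ≤ C) :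
    Integrable (fun g => g i * F g) (stdGaussianPi n) :=
  (integrable_eval_stdGaussianPi i).mul_bdd hF.aestronglyMeasurable (ae_of_all _ hC)

/-- Gaussian integration by parts in the `i`-th coordinate. -/
theorem integral_eval_mul_stdGaussianPi {n : ℕ} (i : Fin n) {F F' : (Fin n → ℝ) → ℝ} {C C' : ℝ}
    (hF : Continuous F) (hF' : Continuous F') (hC : ∀ g, |F g| ≤ C) (hC' : ∀ g, |F' g| ≤ C')
    (hd : ∀ g, HasDerivAt (fun s => F (Function.update g i s)) (F' g) (g i)) :
    ∫ g, g i * F g ∂(stdGaussianPi n) = ∫ g, F' g ∂(stdGaussianPi n) := by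
  cases n with
  | zero => exact i.elim0
  | succ n =>
    -- Split off the `i`-th coordinate; by Fubini the one-dimensional identity applies with the
    -- others frozen.
    have hmp := (measurePreserving_piFinSuccAbove
      (fun _ : Fin (n + 1) => gaussianReal 0 1) i).symm
    have hL := integrable_eval_mul_stdGaussianPi i hF hC
    have hR : Integrable F' (stdGaussianPi (n + 1)) := integrable_of_continuous_of_bounded hF' hC'
    rw [← hmp.integrable_comp_emb (MeasurableEquiv.measurableEmbedding _)] at hL hR
    rw [← hmp.integral_comp', ← hmp.integral_comp']
    refine (integral_prod_symm _ hL).trans (Eq.trans ?_ (integral_prod_symm _ hR).symm)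
    congr 1
    ext y
    simp only [Function.comp_apply, MeasurableEquiv.piFinSuccAbove_symm_apply, Fin.insertNthEquiv,
      Equiv.coe_fn_mk, Fin.insertNth_apply_same]
    have hins : Continuous fun x : ℝ => (i.insertNth x y : Fin (n + 1) → ℝ) :=
      Continuous.finInsertNth (A := fun _ => ℝ) i continuous_id continuous_const
    refine integral_id_mul_gaussianReal (f := fun x => F (i.insertNth x y))
      (f' := fun x => F' (i.insertNth x y)) (fun x => ?_) (hF'.comp hins)
      (fun x => hC _) (fun x => hC' _)
    simpa using hd (i.insertNth x y)

theorem ProbabilityTheory.HasSubgaussianMGF.measureReal_abs_ge_le {Ω : Type*} [MeasurableSpace Ω]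
    {μ : Measure Ω} [IsFiniteMeasure μ] {X : Ω → ℝ} {c : NNReal} (h : HasSubgaussianMGF X c μ)
    {ε : ℝ} (hε : 0 ≤ ε) :
    μ.real {ω | ε ≤ |X ω|} ≤ 2 * Real.exp (-ε ^ 2 / (2 * c)) := by
  have hsub : {ω | ε ≤ |X ω|} ⊆ {ω | ε ≤ X ω} ∪ {ω | ε ≤ (-X) ω} :=
    fun ω (hω : ε ≤ |X ω|) => le_abs.1 hω
  refine (measureReal_mono hsub).trans ((measureReal_union_le _ _).trans ?_)
  rw [two_mul]
  exact add_le_add (h.measure_ge_le hε) (h.neg.measure_ge_le hε)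

/-! ### Gaussian concentration for sums of cosines -/

section CosineSums

variable {ι : Type*} [Fintype ι] {n : ℕ}

/-- The function `y ↦ ∑ⱼ cos ⟨uⱼ, y⟩`. -/
noncomputable def cosSum (u : ι → Fin n → ℝ) (y : Fin n → ℝ) : ℝ :=
  ∑ j, Real.cos (∑ i, u j i * y i)

/-- Minus the `i`-th partial derivative of `cosSum u`. -/
noncomputable def sinSum (u : ι → Fin n → ℝ) (i : Fin n) (y : Fin n → ℝ) : ℝ :=
  ∑ j, u j i * Real.sin (∑ i, u j i * y i)

/-- Minus the second `i`-th partial derivative of `cosSum u`. -/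
noncomputable def sqCosSum (u : ι → Fin n → ℝ) (i : Fin n) (y : Fin n → ℝ) : ℝ :=
  ∑ j, u j i ^ 2 * Real.cos (∑ i, u j i * y i)

@[fun_prop]
theorem continuous_cosSum (u : ι → Fin n → ℝ) : Continuous (cosSum u) := by
  unfold cosSum; fun_prop

@[fun_prop]
theorem continuous_sinSum (u : ι → Fin n → ℝ) (i : Fin n) : Continuous (sinSum u i) := by
  unfold sinSum; fun_prop

@[fun_prop]
theorem continuous_sqCosSum (u : ι → Fin n → ℝ) (i : Fin n) : Continuous (sqCosSum u i) := by
  unfold sqCosSum; fun_prop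

theorem abs_cosSum_le (u : ι → Fin n → ℝ) (y : Fin n → ℝ) :
    |cosSum u y| ≤ Fintype.card ι := by
  refine (Finset.abs_sum_le_sum_abs _ _).trans
    ((Finset.sum_le_sum fun j _ => Real.abs_cos_le_one _).trans ?_)
  simp

theorem abs_sinSum_le (u : ι → Fin n → ℝ) (i : Fin n) (y : Fin n → ℝ) :
    |sinSum u i y| ≤ ∑ j, |u j i| := by
  refine (Finset.abs_sum_le_sum_abs _ _).trans (Finset.sum_le_sum fun j _ => ?_)
  rw [abs_mul]
  exact mul_le_of_le_one_right (abs_nonneg _) (Real.abs_sin_le_one _)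

theorem abs_sqCosSum_le (u : ι → Fin n → ℝ) (i : Fin n) (y : Fin n → ℝ) :
    |sqCosSum u i y| ≤ ∑ j, u j i ^ 2 := by
  refine (Finset.abs_sum_le_sum_abs _ _).trans (Finset.sum_le_sum fun j _ => ?_)
  rw [abs_mul, abs_of_nonneg (sq_nonneg (u j i))]
  exact mul_le_of_le_one_right (sq_nonneg _) (Real.abs_cos_le_one _)

/-- The eigenfunction property `-ΔF = ρ F`; it is where the equal norms of the forms enter. -/
theorem sum_sqCosSum {u : ι → Fin n → ℝ} {ρ : ℝ} (hρ : ∀ j, ∑ i, u j i ^ 2 = ρ)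
    (y : Fin n → ℝ) : ∑ i, sqCosSum u i y = ρ * cosSum u y := by
  simp only [sqCosSum, cosSum]
  rw [Finset.sum_comm, Finset.mul_sum]
  exact Finset.sum_congr rfl fun j _ => by rw [← Finset.sum_mul, hρ j]

theorem hasDerivAt_sum_mul_smul (w g : Fin n → ℝ) (t : ℝ) :
    HasDerivAt (fun t : ℝ => ∑ i, w i * (t • g) i) (∑ i, w i * g i) t := by
  refine HasDerivAt.fun_sum fun i _ => ?_
  simpa using ((hasDerivAt_id t).mul_const (g i)).const_mul (w i)

theorem hasDerivAt_cosSum_smul (u : ι → Fin n → ℝ) (g : Fin n → ℝ) (t : ℝ) :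
    HasDerivAt (fun t : ℝ => cosSum u (t • g)) (-∑ i, g i * sinSum u i (t • g)) t := by
  refine (HasDerivAt.fun_sum fun j _ => (hasDerivAt_sum_mul_smul (u j) g t).cos).congr_deriv ?_
  simp only [sinSum, Finset.mul_sum, neg_mul, Finset.sum_neg_distrib]
  rw [Finset.sum_comm]
  refine congrArg Neg.neg (Finset.sum_congr rfl fun i _ => Finset.sum_congr rfl fun j _ => ?_)
  ring

theorem hasDerivAt_sum_mul_update (w g : Fin n → ℝ) (i : Fin n) (t : ℝ) :
    HasDerivAt (fun s : ℝ => ∑ k, w k * (t • Function.update g i s) k) (t * w i) (g i) := by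
  have h : ∀ k ∈ Finset.univ, HasDerivAt (fun s : ℝ => w k * (t • Function.update g i s) k)
      (if k = i then t * w i else 0) (g i) := by
    intro k _
    by_cases hk : k = i
    · subst hk
      simp only [Pi.smul_apply, Function.update_self, smul_eq_mul, if_true]
      refine (((hasDerivAt_id (g k)).const_mul t).const_mul (w k)).congr_deriv (by ring)
    · simp only [Pi.smul_apply, Function.update_of_ne hk, if_neg hk]
      exact hasDerivAt_const _ _
  exact (HasDerivAt.fun_sum h).congr_deriv (by simp)

theorem hasDerivAt_cosSum_update (u : ι → Fin n → ℝ) (g : Fin n → ℝ) (i : Fin n) (t : ℝ) :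
    HasDerivAt (fun s : ℝ => cosSum u (t • Function.update g i s))
      (-(t * sinSum u i (t • g))) (g i) := by
  refine (HasDerivAt.fun_sum fun j _ =>
    (hasDerivAt_sum_mul_update (u j) g i t).cos).congr_deriv ?_
  simp only [sinSum, Finset.mul_sum, neg_mul, Finset.sum_neg_distrib, Function.update_eq_self]
  refine congrArg Neg.neg (Finset.sum_congr rfl fun j _ => ?_)
  ring

theorem hasDerivAt_sinSum_update (u : ι → Fin n → ℝ) (g : Fin n → ℝ) (i : Fin n) (t : ℝ) :
    HasDerivAt (fun s : ℝ => sinSum u i (t • Function.update g i s))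
      (t * sqCosSum u i (t • g)) (g i) := by
  refine (HasDerivAt.fun_sum fun j _ =>
    ((hasDerivAt_sum_mul_update (u j) g i t).sin).const_mul (u j i)).congr_deriv ?_
  simp only [sqCosSum, Finset.mul_sum, Function.update_eq_self]
  refine Finset.sum_congr rfl fun j _ => ?_
  ring

theorem exp_mul_cosSum_le (u : ι → Fin n → ℝ) (c : ℝ) (y : Fin n → ℝ) :
    Real.exp (c * cosSum u y) ≤ Real.exp (|c| * Fintype.card ι) := by
  refine Real.exp_le_exp.2 ((le_abs_self _).trans ?_)
  rw [abs_mul]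
  exact mul_le_mul_of_nonneg_left (abs_cosSum_le u y) (abs_nonneg c)

/-- Integration by parts for the gradient term of the interpolation. -/
theorem integral_eval_mul_sinSum_mul_exp (u : ι → Fin n → ℝ) (i : Fin n) (c t : ℝ) :
    ∫ g, g i * (sinSum u i (t • g) * Real.exp (c * cosSum u (t • g))) ∂(stdGaussianPi n) =
      ∫ g, (t * sqCosSum u i (t • g) - c * t * sinSum u i (t • g) ^ 2) *
        Real.exp (c * cosSum u (t • g)) ∂(stdGaussianPi n) := by
  refine integral_eval_mul_stdGaussianPi i
    (C := (∑ j, |u j i|) * Real.exp (|c| * Fintype.card ι))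
    (C' := (|t| * (∑ j, u j i ^ 2) + |c * t| * (∑ j, |u j i|) ^ 2) *
      Real.exp (|c| * Fintype.card ι))
    (by fun_prop) (by fun_prop) (fun g => ?_) (fun g => ?_) (fun g => ?_)
  · rw [abs_mul, Real.abs_exp]
    exact mul_le_mul (abs_sinSum_le u i _) (exp_mul_cosSum_le u c _) (Real.exp_nonneg _)
      (Finset.sum_nonneg fun _ _ => abs_nonneg _)
  · rw [abs_mul, Real.abs_exp]
    refine mul_le_mul ((abs_sub _ _).trans ?_) (exp_mul_cosSum_le u c _) (Real.exp_nonneg _)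
      (by positivity)
    rw [abs_mul, abs_mul (c * t), abs_pow]
    gcongr
    · exact abs_sqCosSum_le u i _
    · exact abs_sinSum_le u i _
  · refine ((hasDerivAt_sinSum_update u g i t).mul
      (((hasDerivAt_cosSum_update u g i t).const_mul c).exp)).congr_deriv ?_
    simp only [Function.update_eq_self]
    ring

/-- The derivative of the exponential along the Gaussian interpolation. -/
theorem hasDerivAt_exp_mul_cosSum_smul (u : ι → Fin n → ℝ) (lam ρ : ℝ) (g : Fin n → ℝ) (t : ℝ) :
    HasDerivAt
      (fun t : ℝ => Real.exp (lam * Real.exp (-(1 - t ^ 2) * ρ / 2) * cosSum u (t • g)))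
      (lam * Real.exp (-(1 - t ^ 2) * ρ / 2) *
        ((t * ρ * cosSum u (t • g) - ∑ i, g i * sinSum u i (t • g)) *
        Real.exp (lam * Real.exp (-(1 - t ^ 2) * ρ / 2) * cosSum u (t • g)))) t := by
  have h : HasDerivAt (fun t : ℝ => -(1 - t ^ 2) * ρ / 2) (t * ρ) t := by
    refine ((((hasDerivAt_pow 2 t).const_sub 1).neg.mul_const ρ).div_const 2).congr_deriv ?_
    simp
    ring
  refine ((h.exp.const_mul lam).mul (hasDerivAt_cosSum_smul u g t)).exp.congr_deriv ?_
  simp only [Pi.mul_apply]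
  ring

theorem hasDerivAt_integral_exp_mul_cosSum_smul (u : ι → Fin n → ℝ) (lam : ℝ) {ρ : ℝ}
    (hρ : 0 ≤ ρ) {t : ℝ} (ht : t ∈ Set.Ioo (-1 : ℝ) 2) :
    HasDerivAt (fun t : ℝ => ∫ g, Real.exp (lam * Real.exp (-(1 - t ^ 2) * ρ / 2) *
        cosSum u (t • g)) ∂(stdGaussianPi n))
      (∫ g, lam * Real.exp (-(1 - t ^ 2) * ρ / 2) *
        ((t * ρ * cosSum u (t • g) - ∑ i, g i * sinSum u i (t • g)) *
        Real.exp (lam * Real.exp (-(1 - t ^ 2) * ρ / 2) * cosSum u (t • g)))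
          ∂(stdGaussianPi n)) t := by
  -- For `s` in `(-1, 2)` the exponent is at most `3ρ/2`, hence at most `2ρ`. The open interval
  -- contains `[0, 1]`, so the endpoints need no one-sided derivatives.
  set B : ℝ := |lam| * Real.exp (2 * ρ)
  have hB : ∀ s ∈ Set.Ioo (-1 : ℝ) 2, |lam * Real.exp (-(1 - s ^ 2) * ρ / 2)| ≤ B := by
    intro s hs
    rw [abs_mul, Real.abs_exp]
    refine mul_le_mul_of_nonneg_left (Real.exp_le_exp.2 ?_) (abs_nonneg _)
    have : s ^ 2 ≤ 4 := by nlinarith [hs.1, hs.2]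
    nlinarith
  refine (hasDerivAt_integral_of_dominated_loc_of_deriv_le
    (bound := fun g => B * ((2 * ρ * Fintype.card ι + ∑ i, |g i| * ∑ j, |u j i|) *
      Real.exp (B * Fintype.card ι)))
    (Ioo_mem_nhds ht.1 ht.2) (Filter.Eventually.of_forall fun s => ?_) ?_ ?_
    (ae_of_all _ fun g s hs => ?_) ?_
    (ae_of_all _ fun g s _ => hasDerivAt_exp_mul_cosSum_smul u lam ρ g s)).2
  · exact Continuous.aestronglyMeasurable (by fun_prop)
  · refine integrable_of_continuous_of_bounded (by fun_prop) fun g =>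
      (Real.abs_exp _).trans_le (exp_mul_cosSum_le u _ _)
  · exact Continuous.aestronglyMeasurable (by fun_prop)
  · rw [Real.norm_eq_abs, abs_mul (lam * _), abs_mul (_ - _), Real.abs_exp]
    have hs' : |s| ≤ 2 := abs_le.2 ⟨by linarith [hs.1], hs.2.le⟩
    refine mul_le_mul (hB s hs) (mul_le_mul ((abs_sub _ _).trans (add_le_add ?_ ?_)) ?_
      (Real.exp_nonneg _) (by positivity)) (by positivity) (by positivity)
    · rw [abs_mul, abs_mul, abs_of_nonneg hρ]
      gcongr
      exact abs_cosSum_le u _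
    · refine (Finset.abs_sum_le_sum_abs _ _).trans (Finset.sum_le_sum fun i _ => ?_)
      rw [abs_mul]
      gcongr
      exact abs_sinSum_le u i _
    · refine (exp_mul_cosSum_le u _ _).trans (Real.exp_le_exp.2 ?_)
      gcongr
      exact hB s hs
  · refine ((Integrable.add (integrable_const _) ?_).mul_const _).const_mul _
    exact integrable_finsetSum _ fun i _ => (integrable_eval_stdGaussianPi i).abs.mul_const _

/-- Integration by parts turns the term `∑ gᵢ ∂ᵢF` into `t ρ F` minus a squared gradient. The first
part cancels exactly, and the derivative becomes `c² t E[|∇F|² e^{cF}]` at `t g`, where `|∇F|² ≤ K`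
and `c² ≤ lam²`. -/
theorem deriv_integral_exp_mul_cosSum_smul_le (u : ι → Fin n → ℝ) (lam : ℝ) {ρ K : ℝ}
    (hρ : ∀ j, ∑ i, u j i ^ 2 = ρ) (hK : ∀ y, ∑ i, sinSum u i y ^ 2 ≤ K) (hρ0 : 0 ≤ ρ)
    {t : ℝ} (ht : t ∈ Set.Icc (0 : ℝ) 1) :
    ∫ g, lam * Real.exp (-(1 - t ^ 2) * ρ / 2) *
        ((t * ρ * cosSum u (t • g) - ∑ i, g i * sinSum u i (t • g)) *
        Real.exp (lam * Real.exp (-(1 - t ^ 2) * ρ / 2) * cosSum u (t • g)))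
          ∂(stdGaussianPi n) ≤
      lam ^ 2 * K * t * ∫ g, Real.exp (lam * Real.exp (-(1 - t ^ 2) * ρ / 2) *
        cosSum u (t • g)) ∂(stdGaussianPi n) := by
  set c : ℝ := lam * Real.exp (-(1 - t ^ 2) * ρ / 2) with hc
  have hK0 : 0 ≤ K := (Finset.sum_nonneg fun i _ => sq_nonneg _).trans (hK 0)
  have hc2 : c ^ 2 ≤ lam ^ 2 := by
    rw [hc, mul_pow]
    refine mul_le_of_le_one_right (sq_nonneg _) (pow_le_one₀ (Real.exp_nonneg _) ?_)
    rw [Real.exp_le_one_iff]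
    have : t ^ 2 ≤ 1 := pow_le_one₀ ht.1 ht.2
    nlinarith
  have hexp : ∀ g : Fin n → ℝ, |Real.exp (c * cosSum u (t • g))| ≤
      Real.exp (|c| * Fintype.card ι) := fun g => by
    rw [Real.abs_exp]; exact exp_mul_cosSum_le u c _
  have hint : Integrable (fun g => Real.exp (c * cosSum u (t • g))) (stdGaussianPi n) :=
    integrable_of_continuous_of_bounded (by fun_prop) hexp
  have hbdd : ∀ {f : (Fin n → ℝ) → ℝ} {C : ℝ}, Continuous f → (∀ g, |f g| ≤ C) →
      Integrable (fun g => f g * Real.exp (c * cosSum u (t • g))) (stdGaussianPi n) :=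
    fun hf hC => hint.bdd_mul hf.aestronglyMeasurable (ae_of_all _ hC)
  have hcos : Integrable (fun g => cosSum u (t • g) * Real.exp (c * cosSum u (t • g)))
      (stdGaussianPi n) := hbdd (by fun_prop) fun g => abs_cosSum_le u _
  have hsq : ∀ i, Integrable (fun g => sqCosSum u i (t • g) * Real.exp (c * cosSum u (t • g)))
      (stdGaussianPi n) := fun i => hbdd (by fun_prop) fun g => abs_sqCosSum_le u i _
  have hsin2 : ∀ i, Integrable (fun g => sinSum u i (t • g) ^ 2 *
      Real.exp (c * cosSum u (t • g))) (stdGaussianPi n) := fun i =>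
    hbdd (C := (∑ j, |u j i|) ^ 2) (by fun_prop) fun g => by
      rw [abs_pow]
      exact pow_le_pow_left₀ (abs_nonneg _) (abs_sinSum_le u i _) 2
  have hgsin : ∀ i, Integrable (fun g => g i * (sinSum u i (t • g) *
      Real.exp (c * cosSum u (t • g)))) (stdGaussianPi n) := fun i =>
    integrable_eval_mul_stdGaussianPi i
      (C := (∑ j, |u j i|) * Real.exp (|c| * Fintype.card ι)) (by fun_prop) fun g => by
      rw [abs_mul]
      exact mul_le_mul (abs_sinSum_le u i _) (hexp g) (abs_nonneg _)
        (Finset.sum_nonneg fun _ _ => abs_nonneg _)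
  have hparts : ∑ i, ∫ g, g i * (sinSum u i (t • g) * Real.exp (c * cosSum u (t • g)))
      ∂(stdGaussianPi n) =
      t * ρ * ∫ g, cosSum u (t • g) * Real.exp (c * cosSum u (t • g)) ∂(stdGaussianPi n) -
      c * t * ∫ g, (∑ i, sinSum u i (t • g) ^ 2) * Real.exp (c * cosSum u (t • g))
        ∂(stdGaussianPi n) := by
    have h1 : ∀ i, ∫ g, g i * (sinSum u i (t • g) * Real.exp (c * cosSum u (t • g)))
        ∂(stdGaussianPi n) =
        t * ∫ g, sqCosSum u i (t • g) * Real.exp (c * cosSum u (t • g)) ∂(stdGaussianPi n) -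
        c * t * ∫ g, sinSum u i (t • g) ^ 2 * Real.exp (c * cosSum u (t • g))
          ∂(stdGaussianPi n) := fun i => by
      rw [integral_eval_mul_sinSum_mul_exp, ← integral_const_mul, ← integral_const_mul,
        ← integral_sub ((hsq i).const_mul _) ((hsin2 i).const_mul _)]
      congr 1
      ext g
      ring
    simp_rw [h1]
    rw [Finset.sum_sub_distrib, ← Finset.mul_sum, ← Finset.mul_sum,
      ← integral_finsetSum _ fun i _ => hsq i, ← integral_finsetSum _ fun i _ => hsin2 i]
    simp_rw [← Finset.sum_mul, sum_sqCosSum hρ, mul_assoc ρ, integral_const_mul]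
    ring
  have hsum : ∫ g, (∑ i, sinSum u i (t • g) ^ 2) * Real.exp (c * cosSum u (t • g))
      ∂(stdGaussianPi n) ≤ K * ∫ g, Real.exp (c * cosSum u (t • g)) ∂(stdGaussianPi n) := by
    rw [← integral_const_mul]
    refine integral_mono ?_ (hint.const_mul K) fun g =>
      mul_le_mul_of_nonneg_right (hK _) (Real.exp_nonneg _)
    simp_rw [Finset.sum_mul]
    exact integrable_finsetSum _ fun i _ => hsin2 i
  have hsplit : ∫ g, c * ((t * ρ * cosSum u (t • g) - ∑ i, g i * sinSum u i (t • g)) *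
      Real.exp (c * cosSum u (t • g))) ∂(stdGaussianPi n) =
      c ^ 2 * t * ∫ g, (∑ i, sinSum u i (t • g) ^ 2) * Real.exp (c * cosSum u (t • g))
        ∂(stdGaussianPi n) := by
    rw [integral_const_mul]
    simp_rw [sub_mul, Finset.sum_mul, mul_assoc]
    rw [integral_sub (((hcos.const_mul ρ).const_mul t)) (integrable_finsetSum _ fun i _ => hgsin i),
      integral_finsetSum _ fun i _ => hgsin i, hparts, integral_const_mul, integral_const_mul]
    simp_rw [Finset.sum_mul]
    ring
  rw [hsplit]
  have hI : 0 ≤ ∫ g, Real.exp (c * cosSum u (t • g)) ∂(stdGaussianPi n) :=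
    integral_nonneg fun g => Real.exp_nonneg _
  calc _ ≤ c ^ 2 * t * (K * ∫ g, Real.exp (c * cosSum u (t • g)) ∂(stdGaussianPi n)) :=
        mul_le_mul_of_nonneg_left hsum (mul_nonneg (sq_nonneg _) ht.1)
    _ ≤ lam ^ 2 * t * (K * ∫ g, Real.exp (c * cosSum u (t • g)) ∂(stdGaussianPi n)) :=
        mul_le_mul_of_nonneg_right (mul_le_mul_of_nonneg_right hc2 ht.1) (mul_nonneg hK0 hI)
    _ = _ := by ring

/-- Gaussian moment generating function bound for sums of cosines of linear forms of equal
norm, by interpolation. -/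
theorem integral_exp_mul_cosSum_le (u : ι → Fin n → ℝ) (lam : ℝ) {ρ K : ℝ}
    (hρ : ∀ j, ∑ i, u j i ^ 2 = ρ) (hK : ∀ y, ∑ i, sinSum u i y ^ 2 ≤ K) (hρ0 : 0 ≤ ρ) :
    ∫ g, Real.exp (lam * cosSum u g) ∂(stdGaussianPi n) ≤
      Real.exp (lam * (Fintype.card ι * Real.exp (-ρ / 2)) + lam ^ 2 * K / 2) := by
  set φ : ℝ → ℝ := fun t => ∫ g, Real.exp (lam * Real.exp (-(1 - t ^ 2) * ρ / 2) *
    cosSum u (t • g)) ∂(stdGaussianPi n) with hφ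
  have hsub : Set.Icc (0 : ℝ) 1 ⊆ Set.Ioo (-1 : ℝ) 2 := fun t ht =>
    ⟨by linarith [ht.1], by linarith [ht.2]⟩
  have hd : ∀ t ∈ Set.Icc (0 : ℝ) 1, ∃ φ' ≤ lam ^ 2 * K * t * φ t, HasDerivAt φ φ' t :=
    fun t ht => ⟨_, deriv_integral_exp_mul_cosSum_smul_le u lam hρ hK hρ0 ht,
      hasDerivAt_integral_exp_mul_cosSum_smul u lam hρ0 (hsub ht)⟩
  have hw : ∀ t : ℝ, HasDerivAt (fun t : ℝ => Real.exp (-(lam ^ 2 * K * t ^ 2 / 2)))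
      (-(lam ^ 2 * K * t) * Real.exp (-(lam ^ 2 * K * t ^ 2 / 2))) t := fun t => by
    refine ((((hasDerivAt_pow 2 t).const_mul (lam ^ 2 * K)).div_const 2).neg.exp).congr_deriv ?_
    simp
    ring
  -- Grönwall with an integrating factor: `φ' ≤ lam² K t φ` makes this product nonincreasing on `[0,
  -- 1]`.
  have hanti : AntitoneOn (fun t => φ t * Real.exp (-(lam ^ 2 * K * t ^ 2 / 2)))
      (Set.Icc 0 1) := by
    refine antitoneOn_of_deriv_nonpos (convex_Icc 0 1) (fun t ht => ?_) (fun t ht => ?_)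
      (fun t ht => ?_)
    · obtain ⟨φ', -, h⟩ := hd t ht
      exact (h.mul (hw t)).continuousAt.continuousWithinAt
    · obtain ⟨φ', -, h⟩ := hd t (interior_subset ht)
      exact (h.mul (hw t)).differentiableAt.differentiableWithinAt
    · obtain ⟨φ', hle, h⟩ := hd t (interior_subset ht)
      have := (h.mul (hw t)).deriv
      rw [show (fun t => φ t * Real.exp (-(lam ^ 2 * K * t ^ 2 / 2))) =
        φ * fun t => Real.exp (-(lam ^ 2 * K * t ^ 2 / 2)) from rfl, this]
      have := mul_le_mul_of_nonneg_right hle (Real.exp_nonneg (-(lam ^ 2 * K * t ^ 2 / 2)))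
      linarith
  have h01 := hanti (Set.left_mem_Icc.2 zero_le_one) (Set.right_mem_Icc.2 zero_le_one) zero_le_one
  have h0 : φ 0 = Real.exp (lam * (Fintype.card ι * Real.exp (-ρ / 2))) := by
    simp only [hφ, zero_smul, cosSum, Pi.zero_apply, mul_zero, Finset.sum_const_zero,
      Real.cos_zero, Finset.sum_const, Finset.card_univ, nsmul_eq_mul, mul_one,
      integral_const, probReal_univ, one_smul]
    norm_num
    ring
  have h1 : φ 1 = ∫ g, Real.exp (lam * cosSum u g) ∂(stdGaussianPi n) := by
    simp [hφ]
  simp only [h0, h1, one_pow, mul_one] at h01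
  rw [Real.exp_neg, ← div_eq_mul_inv, div_le_iff₀ (Real.exp_pos _)] at h01
  rw [Real.exp_add]
  simpa using h01

/-- Two-sided Gaussian concentration for sums of cosines. -/
theorem measureReal_abs_cosSum_sub_ge_le (u : ι → Fin n → ℝ) {ρ K ε : ℝ}
    (hρ : ∀ j, ∑ i, u j i ^ 2 = ρ) (hK : ∀ y, ∑ i, sinSum u i y ^ 2 ≤ K) (hρ0 : 0 ≤ ρ)
    (hε : 0 ≤ ε) :
    (stdGaussianPi n).real {g | ε ≤ |cosSum u g - Fintype.card ι * Real.exp (-ρ / 2)|} ≤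
      2 * Real.exp (-ε ^ 2 / (2 * K)) := by
  have hK0 : 0 ≤ K := (Finset.sum_nonneg fun i _ => sq_nonneg _).trans (hK 0)
  have h : HasSubgaussianMGF (fun g => cosSum u g - Fintype.card ι * Real.exp (-ρ / 2))
      ⟨K, hK0⟩ (stdGaussianPi n) := by
    have heq : ∀ (t : ℝ) (g : Fin n → ℝ),
        Real.exp (t * (cosSum u g - Fintype.card ι * Real.exp (-ρ / 2))) =
        Real.exp (t * cosSum u g) *
          Real.exp (-(t * (Fintype.card ι * Real.exp (-ρ / 2)))) := fun t g => by
      rw [← Real.exp_add]; ring_nf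
    refine ⟨fun t => ?_, fun t => ?_⟩
    · simp_rw [heq]
      exact (integrable_of_continuous_of_bounded (by fun_prop) fun g =>
        (Real.abs_exp _).trans_le (exp_mul_cosSum_le u t g)).mul_const _
    · simp_rw [mgf, heq]
      rw [integral_mul_const]
      refine (mul_le_mul_of_nonneg_right (integral_exp_mul_cosSum_le u t hρ hK hρ0)
        (Real.exp_nonneg _)).trans (le_of_eq ?_)
      rw [← Real.exp_add]
      congr 1
      change _ = K * t ^ 2 / 2
      ring
  exact h.measureReal_abs_ge_le hε

end CosineSums

namespace Fastfood

/-! ### Orthogonality of the Hadamard matrix -/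

section Hadamard

theorem hadamardMatrix_transpose (l : ℕ) : (hadamardMatrix l).transpose = hadamardMatrix l := by
  induction l with
  | zero => rfl
  | succ l ih =>
    simp only [hadamardMatrix, Matrix.transpose_reindex, Matrix.fromBlocks_transpose,
      Matrix.transpose_neg, ih]

theorem hadamardMatrix_mul_self (l : ℕ) :
    hadamardMatrix l * hadamardMatrix l = (2 : ℝ) ^ l • (1 : Matrix _ _ ℝ) := by
  induction l with
  | zero =>
    ext i j
    have : Subsingleton (Fin (2 ^ 0)) := inferInstanceAs (Subsingleton (Fin 1))
    simp [hadamardMatrix, Matrix.mul_apply, Subsingleton.elim i j]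
  | succ l ih =>
    simp only [hadamardMatrix, Matrix.reindex_apply, Matrix.submatrix_mul_equiv,
      Matrix.fromBlocks_multiply, mul_neg, neg_mul, neg_neg, add_neg_cancel, ih]
    have h : Matrix.fromBlocks ((2 : ℝ) ^ (l + 1) • (1 : Matrix (Fin (2 ^ l)) (Fin (2 ^ l)) ℝ)) 0 0
        ((2 : ℝ) ^ (l + 1) • (1 : Matrix (Fin (2 ^ l)) (Fin (2 ^ l)) ℝ)) =
        (2 : ℝ) ^ (l + 1) • 1 := by
      rw [← Matrix.fromBlocks_one, Matrix.fromBlocks_smul]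
      congr 1 <;> exact (smul_zero _).symm
    rw [← two_smul ℝ, smul_smul, ← pow_succ', h, Matrix.submatrix_smul]
    simp only [Pi.smul_apply, Matrix.submatrix_one_equiv]

theorem hadamardMatrix_sq (l : ℕ) (i j : Fin (2 ^ l)) : hadamardMatrix l i j ^ 2 = 1 := by
  induction l with
  | zero => simp [hadamardMatrix]
  | succ l ih =>
    simp only [hadamardMatrix, Matrix.reindex_apply, Matrix.submatrix_apply]
    generalize (finSumFinEquiv.trans _ : Fin (2 ^ l) ⊕ Fin (2 ^ l) ≃ _).symm i = a
    generalize (finSumFinEquiv.trans _ : Fin (2 ^ l) ⊕ Fin (2 ^ l) ≃ _).symm j = b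
    rcases a with a | a <;> rcases b with b | b <;> simp [ih]

/-- `Hᵀ H = H² = d`. This serves both for the norm of `H B v` and for the gradient bound. -/
theorem sum_hadamardMatrix_mulVec_sq (l : ℕ) (w : Fin (2 ^ l) → ℝ) :
    ∑ i, ((hadamardMatrix l).mulVec w) i ^ 2 = (2 : ℝ) ^ l * ∑ i, w i ^ 2 := by
  have h : (hadamardMatrix l).mulVec w ⬝ᵥ (hadamardMatrix l).mulVec w =
      (2 : ℝ) ^ l * (w ⬝ᵥ w) := by
    rw [Matrix.dotProduct_mulVec, ← Matrix.mulVec_transpose, hadamardMatrix_transpose,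
      Matrix.mulVec_mulVec, hadamardMatrix_mul_self, Matrix.smul_mulVec, Matrix.one_mulVec,
      smul_dotProduct, smul_eq_mul]
  simpa only [dotProduct, ← pow_two] using h

end Hadamard

/-! ### Hoeffding's inequality for random signs -/

section SignLaw

theorem ae_signLaw_sq : ∀ᵐ b ∂signLaw, b ^ 2 = 1 := by
  rw [signLaw, ae_add_measure_iff]
  constructor <;> refine Measure.ae_smul_measure ?_ _ <;> rw [ae_dirac_iff (by measurability)] <;>
    norm_num

/-- The moment generating function is `cosh t ≤ exp(t²/2)`. -/
theorem hasSubgaussianMGF_signLaw : HasSubgaussianMGF (fun b : ℝ => b) 1 signLaw := by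
  have hint : ∀ (f : ℝ → ℝ) (a : ℝ), Integrable f ((2⁻¹ : ℝ≥0∞) • Measure.dirac a) := fun f a =>
    (integrable_dirac (by simp)).smul_measure (by simp)
  refine ⟨fun t => ?_, fun t => ?_⟩
  · exact integrable_add_measure.2 ⟨hint _ _, hint _ _⟩
  · rw [mgf, signLaw, integral_add_measure (hint _ _) (hint _ _), integral_smul_measure,
      integral_smul_measure, integral_dirac, integral_dirac]
    refine le_trans (le_of_eq ?_) ((Real.cosh_le_exp_half_sq t).trans (le_of_eq ?_))
    · rw [Real.cosh_eq]
      simp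
      ring
    · simp

theorem measureReal_abs_sum_mul_sign_ge_le {n : ℕ} (w : Fin n → ℝ) {ε : ℝ} (hε : 0 ≤ ε) :
    (Measure.pi fun _ : Fin n => signLaw).real {b | ε ≤ |∑ i, w i * b i|} ≤
      2 * Real.exp (-ε ^ 2 / (2 * ∑ i, w i ^ 2)) := by
  have hX : ∀ i : Fin n, HasSubgaussianMGF (fun b : Fin n → ℝ => w i * b i)
      (⟨w i ^ 2, sq_nonneg _⟩ * 1) (Measure.pi fun _ : Fin n => signLaw) := fun i => by
    refine HasSubgaussianMGF.const_mul ?_ (w i)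
    refine HasSubgaussianMGF.of_map (X := fun b : ℝ => b)
      (Y := fun b : Fin n → ℝ => b i) (measurable_pi_apply i).aemeasurable ?_
    rw [(measurePreserving_eval (fun _ : Fin n => signLaw) i).map_eq]
    exact hasSubgaussianMGF_signLaw
  have hind : iIndepFun (fun (i : Fin n) (b : Fin n → ℝ) => w i * b i)
      (Measure.pi fun _ : Fin n => signLaw) :=
    iIndepFun_pi (X := fun i (b : ℝ) => w i * b) fun i => by fun_prop
  have h := HasSubgaussianMGF.sum_of_iIndepFun hind (s := Finset.univ) fun i _ => hX i
  have hc : ((∑ i : Fin n, (⟨w i ^ 2, sq_nonneg _⟩ * 1 : NNReal) : NNReal) : ℝ) =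
      ∑ i, w i ^ 2 := by
    rw [NNReal.coe_sum]
    exact Finset.sum_congr rfl fun i _ => mul_one (w i ^ 2)
  have h1 := h.measureReal_abs_ge_le hε
  rwa [hc] at h1

end SignLaw

/-! ### The block as a sum of cosines, given the permutation and signs -/

/-- The vector `H B v`. -/
noncomputable def mixed (l : ℕ) (b v : Fin (2 ^ l) → ℝ) : Fin (2 ^ l) → ℝ :=
  (hadamardMatrix l).mulVec fun i => b i * v i

theorem mixed_apply (l : ℕ) (b v : Fin (2 ^ l) → ℝ) (k : Fin (2 ^ l)) :
    mixed l b v k = ∑ i, hadamardMatrix l k i * v i * b i := by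
  simp only [mixed, Matrix.mulVec, dotProduct]
  exact Finset.sum_congr rfl fun i _ => by ring

theorem sum_mixed_sq (l : ℕ) {b : Fin (2 ^ l) → ℝ} (hb : ∀ i, b i ^ 2 = 1)
    (v : Fin (2 ^ l) → ℝ) : ∑ i, mixed l b v i ^ 2 = (2 : ℝ) ^ l * ∑ i, v i ^ 2 := by
  simp only [mixed, sum_hadamardMatrix_mulVec_sq, mul_pow, hb, one_mul]

/-- The coefficients of `d^{-1/2} H G Π a` as linear forms in the diagonal of `G`. -/
noncomputable def blockForm (l : ℕ) (π : Equiv.Perm (Fin (2 ^ l))) (a : Fin (2 ^ l) → ℝ)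
    (j i : Fin (2 ^ l)) : ℝ :=
  (√((2 : ℝ) ^ l))⁻¹ * (hadamardMatrix l j i * a (π i))

theorem block_mulVec (l : ℕ) (p : Params (2 ^ l)) (v : Fin (2 ^ l) → ℝ) (j : Fin (2 ^ l)) :
    (√((2 : ℝ) ^ l))⁻¹ * (block l p).mulVec v j =
      ∑ i, blockForm l p.2.1 (mixed l p.2.2 v) j i * p.1 i := by
  simp only [block, ← Matrix.mulVec_mulVec, Matrix.permMatrix_mulVec]
  have h : (Matrix.diagonal p.2.2).mulVec v = fun i => p.2.2 i * v i := by
    ext i; exact Matrix.mulVec_diagonal _ _ _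
  rw [h]
  simp only [blockForm, mixed]
  rw [Matrix.mulVec, dotProduct, Finset.mul_sum]
  refine Finset.sum_congr rfl fun i _ => ?_
  rw [Matrix.mulVec_diagonal, Function.comp_apply]
  ring

theorem kernelEstimate_eq (l : ℕ) (σ : ℝ) (x x' : EuclideanSpace ℝ (Fin (2 ^ l)))
    (p : Params (2 ^ l)) :
    kernelEstimate l σ x x' p =
      cosSum (blockForm l p.2.1 (mixed l p.2.2 fun i => (x i - x' i) / σ)) p.1 / (2 : ℝ) ^ l := by
  simp only [kernelEstimate, block_mulVec, cosSum]

theorem sum_blockForm_sq (l : ℕ) (π : Equiv.Perm (Fin (2 ^ l))) (a : Fin (2 ^ l) → ℝ)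
    (j : Fin (2 ^ l)) :
    ∑ i, blockForm l π a j i ^ 2 = (∑ i, a i ^ 2) / (2 : ℝ) ^ l := by
  simp only [blockForm, mul_pow, hadamardMatrix_sq, one_mul, inv_pow]
  rw [Real.sq_sqrt (by positivity), ← Finset.mul_sum, Equiv.sum_comp π fun i => a i ^ 2,
    div_eq_inv_mul]

/-- Orthogonality of `H` gains a factor `d` over the row-by-row triangle inequality: the factors
`a_{π i}` are pulled out by their maximum before `‖H s‖² = d ‖s‖²` is used. -/
theorem sum_sinSum_blockForm_sq_le (l : ℕ) (π : Equiv.Perm (Fin (2 ^ l)))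
    {a : Fin (2 ^ l) → ℝ} {M : ℝ} (ha : ∀ i, |a i| ≤ M) (y : Fin (2 ^ l) → ℝ) :
    ∑ i, sinSum (blockForm l π a) i y ^ 2 ≤ M ^ 2 * (2 : ℝ) ^ l := by
  set s : Fin (2 ^ l) → ℝ := fun j => Real.sin (∑ i, blockForm l π a j i * y i) with hs
  have h : ∀ i, sinSum (blockForm l π a) i y =
      (√((2 : ℝ) ^ l))⁻¹ * (a (π i) * (hadamardMatrix l).mulVec s i) := fun i => by
    conv_rhs => rw [← hadamardMatrix_transpose]
    simp only [sinSum, blockForm, Matrix.mulVec, dotProduct, Finset.mul_sum,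
      Matrix.transpose_apply, hs]
    exact Finset.sum_congr rfl fun j _ => by ring
  have hd : (0 : ℝ) < 2 ^ l := by positivity
  calc ∑ i, sinSum (blockForm l π a) i y ^ 2
      = ((2 : ℝ) ^ l)⁻¹ * ∑ i, a (π i) ^ 2 * (hadamardMatrix l).mulVec s i ^ 2 := by
        simp only [h, mul_pow, inv_pow, Real.sq_sqrt hd.le, ← Finset.mul_sum]
    _ ≤ ((2 : ℝ) ^ l)⁻¹ * ∑ i, M ^ 2 * (hadamardMatrix l).mulVec s i ^ 2 := by
        refine mul_le_mul_of_nonneg_left (Finset.sum_le_sum fun i _ => ?_) (by positivity)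
        exact mul_le_mul_of_nonneg_right
          (sq_le_sq' (abs_le.1 (ha _)).1 (abs_le.1 (ha _)).2) (sq_nonneg _)
    _ = M ^ 2 * ∑ i, s i ^ 2 := by
        rw [← Finset.mul_sum, sum_hadamardMatrix_mulVec_sq]
        field_simp
    _ ≤ M ^ 2 * ∑ _i : Fin (2 ^ l), (1 : ℝ) := by
        gcongr with i
        exact Real.sin_sq_le_one _
    _ = M ^ 2 * (2 : ℝ) ^ l := by simp

theorem measurable_kernelEstimate (l : ℕ) (σ : ℝ) (x x' : EuclideanSpace ℝ (Fin (2 ^ l))) :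
    Measurable (kernelEstimate l σ x x') := by
  have h : ∀ i, Measurable fun p : Params (2 ^ l) =>
      mixed l p.2.2 (fun i => (x i - x' i) / σ) (p.2.1 i) := fun i => by
    have : Measurable fun q : Equiv.Perm (Fin (2 ^ l)) × (Fin (2 ^ l) → ℝ) =>
        mixed l q.2 (fun i => (x i - x' i) / σ) (q.1 i) := by
      -- The permutation selects the index being evaluated; as there are finitely many,
      -- measurability is checked for each.
      refine measurable_from_prod_countable_right fun π => ?_
      simp only [mixed_apply]
      fun_prop
    exact this.comp measurable_snd
  rw [funext (kernelEstimate_eq l σ x x')]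
  simp only [cosSum, blockForm]
  fun_prop

theorem sum_sub_div_sq {n : ℕ} (σ : ℝ) (x x' : EuclideanSpace ℝ (Fin n)) :
    ∑ i, ((x i - x' i) / σ) ^ 2 = ‖x - x'‖ ^ 2 / σ ^ 2 := by
  rw [EuclideanSpace.norm_sq_eq, Finset.sum_div]
  simp [div_pow]

/-- The conditional deviation bound, given the permutation and the signs. -/
theorem stdGaussianPi_deviation_le {l : ℕ} {σ δ : ℝ} (hσ : 0 < σ)
    {x x' : EuclideanSpace ℝ (Fin (2 ^ l))} (hx : x ≠ x') (hδ : 0 < δ) (hδ' : δ < 1 / 2)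
    (π : Equiv.Perm (Fin (2 ^ l))) {b : Fin (2 ^ l) → ℝ} (hb : ∀ i, b i ^ 2 = 1)
    (hM : ∀ k, |mixed l b (fun i => (x i - x' i) / σ) k| ≤
      √(2 * (‖x - x'‖ ^ 2 / σ ^ 2) * Real.log (2 * (2 : ℝ) ^ l / δ))) :
    stdGaussianPi (2 ^ l) {g | |kernelEstimate l σ x x' (g, π, b) - rbfKernel σ x x'| ≥
      deviation l σ δ x x'} ≤ ENNReal.ofReal δ := by
  set D : ℝ := (2 : ℝ) ^ l with hD
  set R : ℝ := ‖x - x'‖ ^ 2 / σ ^ 2 with hR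
  have hD1 : 1 ≤ D := one_le_pow₀ one_le_two
  have hD0 : 0 < D := by linarith
  have hR0 : 0 < R := div_pos (pow_pos (norm_pos_iff.2 (sub_ne_zero.2 hx)) 2) (by positivity)
  have hL1 : 0 < Real.log (2 / δ) := Real.log_pos (by rw [lt_div_iff₀ hδ]; linarith)
  have hL2 : 0 < Real.log (2 * D / δ) := Real.log_pos (by rw [lt_div_iff₀ hδ]; linarith)
  set a := mixed l b fun i => (x i - x' i) / σ with ha
  have hρ : ∀ j, ∑ i, blockForm l π a j i ^ 2 = R := fun j => by
    rw [sum_blockForm_sq, sum_mixed_sq l hb, sum_sub_div_sq, ← hD, ← hR]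
    field_simp
  have hdev0 : 0 ≤ deviation l σ δ x x' := by unfold deviation; positivity
  have key := measureReal_abs_cosSum_sub_ge_le (blockForm l π a) (ε := D * deviation l σ δ x x')
    hρ (sum_sinSum_blockForm_sq_le l π hM) hR0.le (mul_nonneg hD0.le hdev0)
  -- The deviation is calibrated here: `(d ε)² = 4 d R log(2/δ) log(2d/δ)` and twice the proxy is `4
  -- d R log(2d/δ)`, leaving `-log(2/δ)`. The division needs `R > 0`, hence `x ≠ x'`.
  have hval : 2 * Real.exp (-(D * deviation l σ δ x x') ^ 2 /
      (2 * (√(2 * R * Real.log (2 * D / δ)) ^ 2 * D))) = δ := by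
    have : -(D * deviation l σ δ x x') ^ 2 /
        (2 * (√(2 * R * Real.log (2 * D / δ)) ^ 2 * D)) = -Real.log (2 / δ) := by
      rw [Real.sq_sqrt (by positivity), div_eq_iff (by positivity)]
      simp only [deviation, mul_pow, inv_pow, ← hD]
      rw [Real.sq_sqrt hD0.le, Real.sq_sqrt (by positivity), hR]
      field_simp
    rw [this, Real.exp_neg, Real.exp_log (by positivity)]
    field_simp
  rw [← hD, hval] at key
  have hset : {g | |kernelEstimate l σ x x' (g, π, b) - rbfKernel σ x x'| ≥
      deviation l σ δ x x'} = {g | D * deviation l σ δ x x' ≤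
        |cosSum (blockForm l π a) g - Fintype.card (Fin (2 ^ l)) * Real.exp (-R / 2)|} := by
    ext g
    have hk : rbfKernel σ x x' = Real.exp (-R / 2) := by
      rw [rbfKernel, hR]
      congr 1
      field_simp
    have hc : ((Fintype.card (Fin (2 ^ l)) : ℕ) : ℝ) = D := by simp [hD]
    simp only [Set.mem_ofPred_eq, kernelEstimate_eq, hk, ge_iff_le, hc, ← hD, ← ha]
    rw [show cosSum (blockForm l π a) g - D * Real.exp (-R / 2) =
      D * (cosSum (blockForm l π a) g / D - Real.exp (-R / 2)) by field_simp, abs_mul,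
      abs_of_pos hD0, mul_le_mul_iff_right₀ hD0]
  rw [hset, ← ofReal_measureReal]
  exact ENNReal.ofReal_le_ofReal key

/-- Each entry of `H B v` is a sign sum with squared weights adding to `R`, so Hoeffding gives `δ/d`
per entry; a union bound over `d` entries follows. -/
theorem pi_signLaw_exists_mixed_gt_le {l : ℕ} {δ : ℝ} {v : Fin (2 ^ l) → ℝ} {R : ℝ}
    (hv : ∑ i, v i ^ 2 = R) (hR : 0 < R) (hδ : 0 < δ) (hδ' : δ < 1 / 2) :
    (Measure.pi fun _ : Fin (2 ^ l) => signLaw)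
      {b | ∃ k, √(2 * R * Real.log (2 * (2 : ℝ) ^ l / δ)) ≤ |mixed l b v k|} ≤
      ENNReal.ofReal δ := by
  set D : ℝ := (2 : ℝ) ^ l with hD
  have hD1 : 1 ≤ D := one_le_pow₀ one_le_two
  have hL2 : 0 < Real.log (2 * D / δ) := Real.log_pos (by rw [lt_div_iff₀ hδ]; linarith)
  have h1 : ∀ k, (Measure.pi fun _ : Fin (2 ^ l) => signLaw).real
      {b | √(2 * R * Real.log (2 * D / δ)) ≤ |mixed l b v k|} ≤ δ / D := fun k => by
    have h := measureReal_abs_sum_mul_sign_ge_le (fun i => hadamardMatrix l k i * v i)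
      (Real.sqrt_nonneg (2 * R * Real.log (2 * D / δ)))
    simp only [mul_pow, hadamardMatrix_sq, one_mul, hv] at h
    simp only [mixed_apply]
    refine h.trans (le_of_eq ?_)
    rw [Real.sq_sqrt (by positivity), show -(2 * R * Real.log (2 * D / δ)) / (2 * R) =
      -Real.log (2 * D / δ) by field_simp, Real.exp_neg, Real.exp_log (by positivity)]
    field_simp
  rw [← ofReal_measureReal, Set.ofPred_exists]
  refine ENNReal.ofReal_le_ofReal ((measureReal_iUnion_fintype_le _).trans
    ((Finset.sum_le_sum fun k _ => h1 k).trans (le_of_eq ?_)))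
  rw [Finset.sum_const, Finset.card_univ, Fintype.card_fin, nsmul_eq_mul]
  push_cast
  rw [← hD]
  field_simp

/-! ### Combining the two sources of randomness -/

theorem law_deviation_le {l : ℕ} {σ δ : ℝ} (hσ : 0 < σ)
    {x x' : EuclideanSpace ℝ (Fin (2 ^ l))} (hx : x ≠ x') (hδ : 0 < δ) :
    law (2 ^ l) {p | |kernelEstimate l σ x x' p - rbfKernel σ x x'| ≥ deviation l σ δ x x'} ≤
      ENNReal.ofReal (2 * δ) := by
  -- For `δ ≥ 1/2` the bound `2δ` is at least `1`; below, both logarithms are positive.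
  rcases le_or_gt (1 / 2) δ with hδ' | hδ'
  · exact prob_le_one.trans (by rw [ENNReal.one_le_ofReal]; linarith)
  have hR0 : 0 < ‖x - x'‖ ^ 2 / σ ^ 2 :=
    div_pos (pow_pos (norm_pos_iff.2 (sub_ne_zero.2 hx)) 2) (by positivity)
  set bad : Set (Equiv.Perm (Fin (2 ^ l)) × (Fin (2 ^ l) → ℝ)) :=
    Set.univ ×ˢ {b | ∃ k, √(2 * (‖x - x'‖ ^ 2 / σ ^ 2) * Real.log (2 * (2 : ℝ) ^ l / δ)) ≤
      |mixed l b (fun i => (x i - x' i) / σ) k|} with hbad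
  have hbadM : MeasurableSet bad := by
    refine MeasurableSet.univ.prod ?_
    rw [Set.ofPred_exists]
    refine MeasurableSet.iUnion fun k => measurableSet_le measurable_const ?_
    simp only [mixed_apply]
    fun_prop
  have hsign : ∀ᵐ q ∂((permLaw (2 ^ l)).prod (Measure.pi fun _ : Fin (2 ^ l) => signLaw)),
      ∀ i, q.2 i ^ 2 = 1 := by
    refine Measure.quasiMeasurePreserving_snd.ae (p := fun b : Fin (2 ^ l) → ℝ => ∀ i, b i ^ 2 = 1) ?_
    exact ae_all_iff.2 fun i =>
      (Measure.quasiMeasurePreserving_eval (fun _ : Fin (2 ^ l) => signLaw) i).ae ae_signLaw_sq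
  have hE : MeasurableSet {p : Params (2 ^ l) |
      |kernelEstimate l σ x x' p - rbfKernel σ x x'| ≥ deviation l σ δ x x'} :=
    measurableSet_le measurable_const (((measurable_kernelEstimate l σ x x').sub_const _).abs)
  rw [law, Measure.prod_apply_symm hE]
  -- Conditionally on `(π, b)`, the failure probability is at most `δ` off the bad set and at most
  -- `1` on it.
  calc _ ≤ ∫⁻ q, ENNReal.ofReal δ + bad.indicator 1 q
        ∂((permLaw (2 ^ l)).prod (Measure.pi fun _ : Fin (2 ^ l) => signLaw)) := by
        refine lintegral_mono_ae ?_
        filter_upwards [hsign] with q hq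
        by_cases hqb : q ∈ bad
        · rw [Set.indicator_of_mem hqb]
          exact prob_le_one.trans le_add_self
        · refine le_add_right (stdGaussianPi_deviation_le hσ hx hδ hδ' q.1 hq fun k => ?_)
          by_contra! hk
          exact hqb ⟨Set.mem_univ _, k, hk.le⟩
    _ = ENNReal.ofReal δ + (Measure.pi fun _ : Fin (2 ^ l) => signLaw)
          {b | ∃ k, √(2 * (‖x - x'‖ ^ 2 / σ ^ 2) * Real.log (2 * (2 : ℝ) ^ l / δ)) ≤
            |mixed l b (fun i => (x i - x' i) / σ) k|} := by
        rw [lintegral_add_left measurable_const, lintegral_indicator_one hbadM, lintegral_const,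
          measure_univ, mul_one, hbad, Measure.prod_prod, measure_univ, one_mul]
    _ ≤ ENNReal.ofReal δ + ENNReal.ofReal δ := by
        gcongr
        exact pi_signLaw_exists_mixed_gt_le (sum_sub_div_sq σ x x') hR0 hδ hδ'
    _ = ENNReal.ofReal (2 * δ) := by rw [two_mul, ENNReal.ofReal_add hδ.le hδ.le]

theorem kernelEstimate_self (l : ℕ) (σ : ℝ) (x : EuclideanSpace ℝ (Fin (2 ^ l)))
    (p : Params (2 ^ l)) : kernelEstimate l σ x x p = 1 := by
  have h : (fun i => (x i - x i) / σ) = (0 : Fin (2 ^ l) → ℝ) := by ext i; simp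
  simp only [kernelEstimate, h, Matrix.mulVec_zero]
  simp

end Fastfood

theorem mainTheorem1 (l : ℕ) (σ : ℝ) (hσ : 0 < σ)
    (x x' : EuclideanSpace ℝ (Fin (2 ^ l))) (δ : ℝ) (hδ : 0 < δ) :
    (x ≠ x' →
      Fastfood.law (2 ^ l)
        {p | |Fastfood.kernelEstimate l σ x x' p - Fastfood.rbfKernel σ x x'|
          ≥ Fastfood.deviation l σ δ x x'} ≤ ENNReal.ofReal (2 * δ)) ∧
    ENNReal.ofReal (1 - 2 * δ) ≤
      Fastfood.law (2 ^ l)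
        {p | |Fastfood.kernelEstimate l σ x x' p - Fastfood.rbfKernel σ x x'|
          ≤ Fastfood.deviation l σ δ x x'} := by
  refine ⟨fun hx => Fastfood.law_deviation_le hσ hx hδ, ?_⟩
  -- For `x = x'` estimate and kernel are both `1` and the deviation is `0`, so the event is
  -- everything; otherwise pass to the complement.
  by_cases hx : x = x'
  · subst hx
    have huniv : {p | |Fastfood.kernelEstimate l σ x x p - Fastfood.rbfKernel σ x x|
        ≤ Fastfood.deviation l σ δ x x} = Set.univ := by
      simp [Fastfood.kernelEstimate_self, Fastfood.rbfKernel, Fastfood.deviation]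
    rw [huniv, measure_univ, ENNReal.ofReal_le_one]
    linarith
  · set A := {p | |Fastfood.kernelEstimate l σ x x' p - Fastfood.rbfKernel σ x x'|
      ≤ Fastfood.deviation l σ δ x x'} with hA
    have hsub : Aᶜ ⊆ {p | |Fastfood.kernelEstimate l σ x x' p - Fastfood.rbfKernel σ x x'|
        ≥ Fastfood.deviation l σ δ x x'} := by
      intro p hp
      rw [hA, Set.mem_compl_iff, Set.mem_ofPred_eq, not_le] at hp
      exact hp.le
    have hcompl : Fastfood.law (2 ^ l) Aᶜ ≤ ENNReal.ofReal (2 * δ) :=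
      (measure_mono hsub).trans (Fastfood.law_deviation_le hσ hx hδ)
    rw [ENNReal.ofReal_sub _ (by positivity), ENNReal.ofReal_one, tsub_le_iff_right]
    calc (1 : ℝ≥0∞) = Fastfood.law (2 ^ l) (A ∪ Aᶜ) := by rw [Set.union_compl_self, measure_univ]
      _ ≤ Fastfood.law (2 ^ l) A + Fastfood.law (2 ^ l) Aᶜ := measure_union_le _ _
      _ ≤ _ := by gcongr
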